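/- A \emph{graphon} is a symmetric Lebesgue measurable function $W:[0,1]^2\to[0,1]$. For graphons $U,V$ let $$d_\Box(U,V)=\sup_{A,B}\Big|\int_{A\times B}(U-V)\,d\lambda^{2}\Big|,\qquad \delta_\Box(U,V)=\inf_{\phi,\psi} d_\Box(U^\phi,V^\psi),$$ where $A,B$ range over measurable subsets of $[0,1]$, $\phi,\psi$ range over measure-preserving maps $[0,1]\to[0,1]$, and $U^\phi(x,y)=U(\phi(x),\phi(y))$. Let $\widetilde{\mathcal W}$ be the separable metric space obtained from the set of graphons with the pseudo-metric $\delta_\Box$ by identifying graphons at $\delta_\Box$-distance $0$. For a complete graph $H$ on $\{1,\dots,n\}$ with edge weights in $[0,1]$, let $f^H$ be the graphon which, for $i\ne j$, equals the weight of $\{i,j\}$ on $I_i\times I_j$, and equals $0$ on each $I_i\times I_i$, where $I_1,\dots,I_n$ are the consecutive intervals of length $1/n$ partitioning $[0,1]$. A graph $G$ is regarded as such an $H$ with weight $1$ on edges and $0$ on non-edges. Let $W$ be a graphon and let $x_1,\dots,x_n$ be independent and uniform on $[0,1]$. Let $\widetilde{\mathbb H}_{n,W}$ be the law on $\widetilde{\mathcal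 W}$ of the class of $f^H$, where $H$ has weight $W(x_i,x_j)$ on each pair $\{i,j\}$. Let $\widetilde{\mathbb R}_{n,W}$ be the law on $\widetilde{\mathcal W}$ of the class of $f^G$, where $G$ is the random graph on $\{1,\dots,n\}$ in which, given $x_1,\dots,x_n$, the pairs $\{i,j\}$ are edges independently with probabilities $W(x_i,x_j)$. Two sequences $(\mu_n)_{n\ge1}$, $(\nu_n)_{n\ge1}$ of Borel probability measures on a separable metric space $(X,d)$ are \emph{exponentially equivalent for speed $s$} if there are Borel probability measures $\Theta_n$ on $X\times X$, $n\ge1$, with marginals $\mu_n$ and $\nu_n$, such that for every $\alpha>0$ $$\limsup_{n\to\infty}\frac1{s(n)}\log\Theta_n\big(\{(x,y):d(x,y)>\alpha\}\big)=-\infty .$$ \textbf{Lemma.} Let $W$ be a graphon and let $s:\{1,2,\dots\}\to(0,\infty)$ satisfy $s(n)\to\infty$ and $s(n)/n^2\to0$ as $n\to\infty$. Then the sequences $(\widetilde{\mathbb R}_{n,W})_{n\ge1}$ and $(\widetilde{\mathbb H}_{n,W})_{n\ge1}$ are exponentially equivalent for speed $s$. -/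

import Mathlib

open MeasureTheory Filter Topology

/-- A graphon: a symmetric Lebesgue measurable function `[0,1]² → [0,1]`.
`NullMeasurable` with respect to `volume` means measurable for the completed σ-algebra. -/
structure Graphon where
  toFun : unitInterval → unitInterval → unitInterval
  symm' : ∀ x y, toFun x y = toFun y x
  measurable' : NullMeasurable (fun p : unitInterval × unitInterval => toFun p.1 p.2) volume

namespace Graphon

instance : CoeFun Graphon (fun _ => unitInterval → unitInterval → unitInterval) := ⟨Graphon.toFun⟩

/-- The pull-back `U^φ(x,y) = U(φ(x),φ(y))` along a measure-preserving map `φ`. -/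
def pullback (U : Graphon) (φ : unitInterval → unitInterval)
    (hφ : MeasurePreserving φ volume volume) : Graphon where
  toFun x y := U (φ x) (φ y)
  symm' _ _ := U.symm' _ _
  measurable' := fun _ hs =>
    (U.measurable' hs).preimage (hφ.prod hφ).quasiMeasurePreserving

/-- The real-valued difference `U - V` on the unit square. -/
def diff (U V : Graphon) (p : unitInterval × unitInterval) : ℝ :=
  (U p.1 p.2 : ℝ) - (V p.1 p.2 : ℝ)

/-- `d_□(U,V) = sup_{A,B} |∫_{A×B} (U - V)|` over measurable `A, B ⊆ [0,1]`. -/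
noncomputable def cutDist (U V : Graphon) : ℝ :=
  sSup {r : ℝ | ∃ A B : Set unitInterval, MeasurableSet A ∧ MeasurableSet B ∧
    r = |∫ p in A ×ˢ B, diff U V p|}

/-- The cut-distance `δ_□(U,V) = inf_{φ,ψ} d_□(U^φ,V^ψ)` over measure-preserving `φ, ψ`. -/
noncomputable def cutDistance (U V : Graphon) : ℝ :=
  sInf {r : ℝ | ∃ (φ ψ : unitInterval → unitInterval)
    (hφ : MeasurePreserving φ volume volume) (hψ : MeasurePreserving ψ volume volume),
    r = cutDist (U.pullback φ hφ) (V.pullback ψ hψ)}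

theorem aestronglyMeasurable_coe (U : Graphon) :
    AEStronglyMeasurable (fun p : unitInterval × unitInterval => (U p.1 p.2 : ℝ)) volume :=
  (measurable_subtype_coe.comp_aemeasurable U.measurable'.aemeasurable).aestronglyMeasurable

theorem abs_diff_le (U V : Graphon) (p : unitInterval × unitInterval) : |diff U V p| ≤ 1 := by
  have h1 := (U p.1 p.2).2
  have h2 := (V p.1 p.2).2
  rw [diff, abs_le]
  constructor <;> linarith [h1.1, h1.2, h2.1, h2.2]

theorem aestronglyMeasurable_diff (U V : Graphon) : AEStronglyMeasurable (diff U V) volume :=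
  U.aestronglyMeasurable_coe.sub V.aestronglyMeasurable_coe

theorem integrable_diff (U V : Graphon) : Integrable (diff U V) volume :=
  Integrable.of_bound (aestronglyMeasurable_diff U V) 1
    (Eventually.of_forall (abs_diff_le U V))

theorem abs_setIntegral_diff_le (U V : Graphon) (S : Set (unitInterval × unitInterval)) :
    |∫ p in S, diff U V p| ≤ ∫ p, |diff U V p| := by
  refine (abs_integral_le_integral_abs).trans ?_
  exact setIntegral_le_integral (integrable_diff U V).abs
    (Eventually.of_forall fun _ => abs_nonneg _)

theorem bddAbove_cutDist (U V : Graphon) :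
    BddAbove {r : ℝ | ∃ A B : Set unitInterval, MeasurableSet A ∧ MeasurableSet B ∧
      r = |∫ p in A ×ˢ B, diff U V p|} := by
  refine ⟨∫ p, |diff U V p|, ?_⟩
  rintro r ⟨A, B, -, -, rfl⟩
  exact abs_setIntegral_diff_le U V _

theorem le_cutDist (U V : Graphon) {A B : Set unitInterval}
    (hA : MeasurableSet A) (hB : MeasurableSet B) :
    |∫ p in A ×ˢ B, diff U V p| ≤ cutDist U V :=
  le_csSup (bddAbove_cutDist U V) ⟨A, B, hA, hB, rfl⟩

theorem cutDist_le (U V : Graphon) {c : ℝ}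
    (h : ∀ A B : Set unitInterval, MeasurableSet A → MeasurableSet B →
      |∫ p in A ×ˢ B, diff U V p| ≤ c) : cutDist U V ≤ c := by
  refine csSup_le ⟨_, ∅, ∅, MeasurableSet.empty, MeasurableSet.empty, rfl⟩ ?_
  rintro r ⟨A, B, hA, hB, rfl⟩
  exact h A B hA hB

theorem cutDist_nonneg (U V : Graphon) : 0 ≤ cutDist U V :=
  (abs_nonneg _).trans (le_cutDist U V MeasurableSet.empty MeasurableSet.empty)

theorem cutDist_self (U : Graphon) : cutDist U U = 0 := by
  refine le_antisymm (cutDist_le U U fun A B _ _ => ?_) (cutDist_nonneg U U)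
  simp [diff]

theorem diff_swap (U V : Graphon) : diff U V = fun p => -diff V U p := by
  funext p
  simp [diff]

theorem cutDist_comm (U V : Graphon) : cutDist U V = cutDist V U := by
  unfold cutDist
  rw [diff_swap U V]
  simp only [integral_neg, abs_neg]

theorem cutDist_triangle (U V W : Graphon) : cutDist U W ≤ cutDist U V + cutDist V W := by
  refine cutDist_le U W fun A B hA hB => ?_
  have h : diff U W = fun p => diff U V p + diff V W p := by
    funext p
    simp [diff]
  rw [h, integral_add (integrable_diff U V).integrableOn (integrable_diff V W).integrableOn]
  exact (abs_add_le _ _).trans (add_le_add (le_cutDist U V hA hB) (le_cutDist V W hA hB))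

/-- Maximizing over the first factor: a measure below Lebesgue is dominated by a set. -/
theorem exists_set_integral_le {F : unitInterval × unitInterval → ℝ} (hF : Measurable F)
    (hb : ∀ p, |F p| ≤ 1) (μ ν : Measure unitInterval) [IsFiniteMeasure μ] [IsFiniteMeasure ν]
    (hμ : μ ≤ volume) :
    ∃ A, MeasurableSet A ∧ ∫ p, F p ∂(μ.prod ν) ≤ ∫ p, F p ∂((volume.restrict A).prod ν) := by
  have hi : ∀ (κ : Measure (unitInterval × unitInterval)) [IsFiniteMeasure κ], Integrable F κ :=
    fun κ _ => Integrable.of_bound hF.aestronglyMeasurable 1 (Eventually.of_forall hb)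
  have hm : StronglyMeasurable fun x => ∫ y, F (x, y) ∂ν :=
    hF.stronglyMeasurable.integral_prod_right'
  refine ⟨{x | 0 ≤ ∫ y, F (x, y) ∂ν}, measurableSet_le measurable_const hm.measurable, ?_⟩
  have hA : MeasurableSet {x | 0 ≤ ∫ y, F (x, y) ∂ν} :=
    measurableSet_le measurable_const hm.measurable
  rw [integral_prod _ (hi _), integral_prod _ (hi _)]
  have h1 : Integrable (fun x => ∫ y, F (x, y) ∂ν) volume := by
    simpa using (hi ((volume : Measure unitInterval).prod ν)).integral_prod_left
  have h2 : Integrable (fun x => ∫ y, F (x, y) ∂ν) μ := h1.mono_measure hμ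
  rw [← integral_indicator hA]
  refine (integral_mono h2 (h2.indicator hA) fun x => ?_).trans
    (integral_mono_measure hμ (Eventually.of_forall fun x => ?_) (h1.indicator hA))
  · by_cases hx : 0 ≤ ∫ y, F (x, y) ∂ν
    · simp [Set.indicator, hx]
    · simp only [Set.indicator, Set.mem_ofPred_eq, hx, if_false]
      exact (not_le.1 hx).le
  · exact Set.indicator_nonneg (fun x hx => hx) x

theorem exists_sets_integral_le {F : unitInterval × unitInterval → ℝ} (hF : Measurable F)
    (hb : ∀ p, |F p| ≤ 1) (μ ν : Measure unitInterval) [IsFiniteMeasure μ] [IsFiniteMeasure ν]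
    (hμ : μ ≤ volume) (hν : ν ≤ volume) :
    ∃ A B, MeasurableSet A ∧ MeasurableSet B ∧
      ∫ p, F p ∂(μ.prod ν) ≤ ∫ p in A ×ˢ B, F p := by
  obtain ⟨A, hA, h1⟩ := exists_set_integral_le hF hb μ ν hμ
  obtain ⟨B, hB, h2⟩ := exists_set_integral_le (F := fun p => F p.swap) (hF.comp measurable_swap)
    (fun p => hb _) ν (volume.restrict A) hν
  refine ⟨A, B, hA, hB, h1.trans ?_⟩
  have e1 := integral_prod_swap (μ := volume.restrict A) (ν := ν) F
  have e2 := integral_prod_swap (μ := volume.restrict A) (ν := volume.restrict B) F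
  rw [← e1]
  refine h2.trans (le_of_eq ?_)
  rw [e2, Measure.prod_restrict]
  rfl

/-- Pulling back along a measure-preserving map does not increase `d_□`. -/
theorem cutDist_pullback_le (U V : Graphon) {a : unitInterval → unitInterval}
    (ha : MeasurePreserving a volume volume) :
    cutDist (U.pullback a ha) (V.pullback a ha) ≤ cutDist U V := by
  refine cutDist_le _ _ fun A B hA hB => ?_
  -- a Borel representative of `U - V`, bounded by one
  obtain ⟨G, hGm, hG⟩ := aestronglyMeasurable_diff U V
  set F : unitInterval × unitInterval → ℝ := fun p => max (-1) (min (G p) 1) with hFdef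
  have hFm : Measurable F := measurable_const.max (hGm.measurable.min measurable_const)
  have hFb : ∀ p, |F p| ≤ 1 := fun p => by
    rw [abs_le]
    exact ⟨le_max_left _ _, max_le (by norm_num) (min_le_right _ _)⟩
  have hFe : diff U V =ᵐ[volume] F := by
    filter_upwards [hG] with p hp
    have := abs_le.1 (abs_diff_le U V p)
    simp only [hFdef, ← hp]
    rw [min_eq_left this.2, max_eq_right this.1]
  set μ : Measure unitInterval := (volume.restrict A).map a
  set ν : Measure unitInterval := (volume.restrict B).map a
  have hμ : μ ≤ volume := by
    calc μ ≤ (volume : Measure unitInterval).map a :=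
          Measure.map_mono Measure.restrict_le_self ha.measurable
      _ = volume := ha.map_eq
  have hν : ν ≤ volume := by
    calc ν ≤ (volume : Measure unitInterval).map a :=
          Measure.map_mono Measure.restrict_le_self ha.measurable
      _ = volume := ha.map_eq
  have key : ∫ p in A ×ˢ B, diff (U.pullback a ha) (V.pullback a ha) p
      = ∫ p, F p ∂(μ.prod ν) := by
    have hprod : μ.prod ν = (volume.restrict (A ×ˢ B)).map (Prod.map a a) := by
      rw [Measure.map_prod_map _ _ ha.measurable ha.measurable, Measure.prod_restrict]
      rfl
    rw [hprod, integral_map (ha.measurable.prodMap ha.measurable).aemeasurable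
      hFm.aestronglyMeasurable]
    refine integral_congr_ae (ae_restrict_of_ae ?_)
    exact (ha.prod ha).quasiMeasurePreserving.ae_eq hFe
  rw [key, abs_le]
  constructor
  · obtain ⟨A', B', hA', hB', h⟩ := exists_sets_integral_le (F := fun p => -F p) hFm.neg
      (fun p => by simpa using hFb p) μ ν hμ hν
    rw [integral_neg, integral_neg] at h
    have h2 := le_cutDist U V hA' hB'
    rw [integral_congr_ae (ae_restrict_of_ae hFe)] at h2
    linarith [neg_le_abs (∫ p in A' ×ˢ B', F p)]
  · obtain ⟨A', B', hA', hB', h⟩ := exists_sets_integral_le hFm hFb μ ν hμ hν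
    have h2 := le_cutDist U V hA' hB'
    rw [integral_congr_ae (ae_restrict_of_ae hFe)] at h2
    linarith [le_abs_self (∫ p in A' ×ˢ B', F p)]

/-- Gluing: two measure-preserving maps to `[0,1]` have a common measure-preserving refinement. -/
theorem exists_common_refinement {φ ψ : unitInterval → unitInterval}
    (hφ : MeasurePreserving φ volume volume) (hψ : MeasurePreserving ψ volume volume) :
    ∃ a b : unitInterval → unitInterval, MeasurePreserving a volume volume ∧
      MeasurePreserving b volume volume ∧ φ ∘ a =ᵐ[volume] ψ ∘ b := by
  classical
  set κ := ProbabilityTheory.condDistrib (id : unitInterval → unitInterval) φ volume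
  set η := ProbabilityTheory.condDistrib (id : unitInterval → unitInterval) ψ volume
  have hκ : volume.compProd κ = (volume : Measure unitInterval).map fun x => (φ x, x) := by
    have := ProbabilityTheory.compProd_map_condDistrib (mβ := inferInstance)
      (μ := (volume : Measure unitInterval)) (X := φ) (Y := id) aemeasurable_id
    rwa [hφ.map_eq] at this
  have hη : volume.compProd η = (volume : Measure unitInterval).map fun x => (ψ x, x) := by
    have := ProbabilityTheory.compProd_map_condDistrib (mβ := inferInstance)
      (μ := (volume : Measure unitInterval)) (X := ψ) (Y := id) aemeasurable_id
    rwa [hψ.map_eq] at this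
  obtain ⟨f, hfm, hf⟩ := Measure.exists_measurable_map_eq
    ((volume : Measure unitInterval).compProd (κ.prod η))
  have h1 : (volume : Measure unitInterval).map (fun t => ((f t).1, (f t).2.1))
      = (volume : Measure unitInterval).map fun x => (φ x, x) := by
    rw [← hκ, ← ProbabilityTheory.Kernel.fst_prod κ η, ProbabilityTheory.Kernel.fst_eq,
      Measure.compProd_map measurable_fst, ← hf, Measure.map_map (by fun_prop) hfm]
    rfl
  have h2 : (volume : Measure unitInterval).map (fun t => ((f t).1, (f t).2.2))
      = (volume : Measure unitInterval).map fun x => (ψ x, x) := by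
    rw [← hη, ← ProbabilityTheory.Kernel.snd_prod κ η, ProbabilityTheory.Kernel.snd_eq,
      Measure.compProd_map measurable_snd, ← hf, Measure.map_map (by fun_prop) hfm]
    rfl
  have aux : ∀ (θ g : unitInterval → unitInterval), Measurable θ → Measurable g →
      (volume : Measure unitInterval).map (fun t => ((f t).1, g t))
        = (volume : Measure unitInterval).map (fun x => (θ x, x)) →
      MeasurePreserving g volume volume ∧ ∀ᵐ t ∂(volume : Measure unitInterval),
        (f t).1 = θ (g t) := by
    intro θ g hθ hg h
    refine ⟨⟨hg, ?_⟩, ?_⟩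
    · have := congrArg (fun m => Measure.map Prod.snd m) h
      rw [Measure.map_map measurable_snd (by fun_prop),
        Measure.map_map measurable_snd (by fun_prop)] at this
      calc (volume : Measure unitInterval).map g = (volume : Measure unitInterval).map id := this
        _ = volume := Measure.map_id
    · have hS : MeasurableSet {p : unitInterval × unitInterval | p.1 = θ p.2} :=
        measurableSet_eq_fun measurable_fst (hθ.comp measurable_snd)
      have h3 : ∀ᵐ p ∂((volume : Measure unitInterval).map (fun x => (θ x, x))),
          p.1 = θ p.2 := by
        rw [ae_map_iff (by fun_prop) hS]
        simp
      rw [← h, ae_map_iff (by fun_prop) hS] at h3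
      exact h3
  obtain ⟨ha, ha'⟩ := aux φ (fun t => (f t).2.1) hφ.measurable (by fun_prop) h1
  obtain ⟨hb, hb'⟩ := aux ψ (fun t => (f t).2.2) hψ.measurable (by fun_prop) h2
  refine ⟨_, _, ha, hb, ?_⟩
  filter_upwards [ha', hb'] with t h h'
  exact h.symm.trans h'

theorem bddBelow_cutDistance (U V : Graphon) :
    BddBelow {r : ℝ | ∃ (φ ψ : unitInterval → unitInterval)
      (hφ : MeasurePreserving φ volume volume) (hψ : MeasurePreserving ψ volume volume),
      r = cutDist (U.pullback φ hφ) (V.pullback ψ hψ)} := by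
  refine ⟨0, ?_⟩
  rintro r ⟨φ, ψ, hφ, hψ, rfl⟩
  exact cutDist_nonneg _ _

theorem nonempty_cutDistance (U V : Graphon) :
    {r : ℝ | ∃ (φ ψ : unitInterval → unitInterval)
      (hφ : MeasurePreserving φ volume volume) (hψ : MeasurePreserving ψ volume volume),
      r = cutDist (U.pullback φ hφ) (V.pullback ψ hψ)}.Nonempty :=
  ⟨_, id, id, MeasurePreserving.id _, MeasurePreserving.id _, rfl⟩

theorem cutDistance_le (U V : Graphon) {φ ψ : unitInterval → unitInterval}
    (hφ : MeasurePreserving φ volume volume) (hψ : MeasurePreserving ψ volume volume) :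
    cutDistance U V ≤ cutDist (U.pullback φ hφ) (V.pullback ψ hψ) :=
  csInf_le (bddBelow_cutDistance U V) ⟨φ, ψ, hφ, hψ, rfl⟩

theorem cutDistance_le_cutDist (U V : Graphon) : cutDistance U V ≤ cutDist U V :=
  cutDistance_le U V (MeasurePreserving.id _) (MeasurePreserving.id _)

theorem cutDistance_nonneg (U V : Graphon) : 0 ≤ cutDistance U V :=
  le_csInf (nonempty_cutDistance U V) fun _ ⟨_, _, _, _, h⟩ => h ▸ cutDist_nonneg _ _

theorem cutDistance_self (U : Graphon) : cutDistance U U = 0 :=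
  le_antisymm ((cutDistance_le_cutDist U U).trans (cutDist_self U).le) (cutDistance_nonneg U U)

theorem cutDistance_comm (U V : Graphon) : cutDistance U V = cutDistance V U := by
  have key : ∀ U V : Graphon, cutDistance U V ≤ cutDistance V U := by
    intro U V
    refine le_csInf (nonempty_cutDistance V U) ?_
    rintro r ⟨φ, ψ, hφ, hψ, rfl⟩
    rw [cutDist_comm]
    exact cutDistance_le U V hψ hφ
  exact le_antisymm (key U V) (key V U)

theorem cutDist_eq_zero_of_ae {U V : Graphon}
    (h : ∀ᵐ p : unitInterval × unitInterval, U p.1 p.2 = V p.1 p.2) : cutDist U V = 0 := by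
  refine le_antisymm (cutDist_le U V fun A B _ _ => ?_) (cutDist_nonneg U V)
  rw [integral_eq_zero_of_ae, abs_zero]
  refine ae_restrict_of_ae ?_
  filter_upwards [h] with p hp
  simp [diff, hp]

theorem cutDistance_triangle (U V W : Graphon) :
    cutDistance U W ≤ cutDistance U V + cutDistance V W := by
  refine le_of_forall_pos_le_add fun ε hε => ?_
  obtain ⟨r, ⟨φ, ψ, hφ, hψ, rfl⟩, hr⟩ :=
    exists_lt_of_csInf_lt (nonempty_cutDistance U V) (lt_add_of_pos_right _ (half_pos hε))
  obtain ⟨r, ⟨φ', ψ', hφ', hψ', rfl⟩, hr'⟩ :=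
    exists_lt_of_csInf_lt (nonempty_cutDistance V W) (lt_add_of_pos_right _ (half_pos hε))
  obtain ⟨a, b, ha, hb, hab⟩ := exists_common_refinement hψ hφ'
  have h0 : cutDist ((V.pullback ψ hψ).pullback a ha) ((V.pullback φ' hφ').pullback b hb) = 0 := by
    apply cutDist_eq_zero_of_ae
    have h1 := (MeasurePreserving.quasiMeasurePreserving
      (measurePreserving_fst (μ := (volume : Measure unitInterval))
        (ν := (volume : Measure unitInterval)))).ae hab
    have h2 := (MeasurePreserving.quasiMeasurePreserving
      (measurePreserving_snd (μ := (volume : Measure unitInterval))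
        (ν := (volume : Measure unitInterval)))).ae hab
    filter_upwards [h1, h2] with p hp1 hp2
    simp only [Function.comp] at hp1 hp2
    simp only [pullback, hp1, hp2]
  have h1 := cutDistance_le U W (hφ.comp ha) (hψ'.comp hb)
  have h2 : cutDist (U.pullback _ (hφ.comp ha)) (W.pullback _ (hψ'.comp hb)) ≤
      cutDist ((U.pullback φ hφ).pullback a ha) ((V.pullback ψ hψ).pullback a ha) +
      (cutDist ((V.pullback ψ hψ).pullback a ha) ((V.pullback φ' hφ').pullback b hb) +
      cutDist ((V.pullback φ' hφ').pullback b hb) ((W.pullback ψ' hψ').pullback b hb)) :=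
    (cutDist_triangle _ _ _).trans (add_le_add le_rfl (cutDist_triangle _ _ _))
  have h3 := cutDist_pullback_le (U.pullback φ hφ) (V.pullback ψ hψ) ha
  have h4 := cutDist_pullback_le (V.pullback φ' hφ') (W.pullback ψ' hψ') hb
  unfold cutDistance at *
  linarith

/-- The cut-distance is a pseudo-metric on the set of graphons. -/
noncomputable instance : PseudoMetricSpace Graphon where
  dist := cutDistance
  dist_self := cutDistance_self
  dist_comm := cutDistance_comm
  dist_triangle := cutDistance_triangle

theorem dist_eq_cutDistance (U V : Graphon) : dist U V = cutDistance U V := rfl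

theorem dist_le_integral (U V : Graphon) : dist U V ≤ ∫ p, |diff U V p| :=
  (cutDistance_le_cutDist U V).trans
    (cutDist_le U V fun _ _ _ _ => abs_setIntegral_diff_le U V _)

theorem integrable_coe (U : Graphon) :
    Integrable (fun p : unitInterval × unitInterval => (U p.1 p.2 : ℝ)) volume :=
  Integrable.of_bound U.aestronglyMeasurable_coe 1 (Eventually.of_forall fun p => by
    rw [Real.norm_eq_abs, abs_of_nonneg (U p.1 p.2).2.1]
    exact (U p.1 p.2).2.2)

/-- The graphon viewed in `L¹([0,1]²)`. -/
noncomputable def toL1 (U : Graphon) :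
    Lp ℝ 1 (volume : Measure (unitInterval × unitInterval)) :=
  U.integrable_coe.toL1 _

theorem dist_le_dist_toL1 (U V : Graphon) : dist U V ≤ dist U.toL1 V.toL1 := by
  refine (dist_le_integral U V).trans (le_of_eq ?_)
  rw [L1.dist_eq_integral_dist]
  refine integral_congr_ae ?_
  filter_upwards [U.integrable_coe.coeFn_toL1, V.integrable_coe.coeFn_toL1] with p h1 h2
  rw [toL1, toL1, h1, h2, Real.dist_eq, diff]

theorem exists_countable_dense_toL1 : ∃ c : Set Graphon, c.Countable ∧
    ∀ (U : Graphon) (ε : ℝ), 0 < ε → ∃ V ∈ c, dist U.toL1 V.toL1 < ε := by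
  have : Fact ((1 : ENNReal) ≠ ⊤) := ⟨ENNReal.one_ne_top⟩
  have : SecondCountableTopology (Lp ℝ 1 (volume : Measure (unitInterval × unitInterval))) :=
    have := MeasureTheory.isSeparable_of_sigmaFinite
      (volume : Measure (unitInterval × unitInterval))
    Lp.SecondCountableTopology
  let t : PseudoMetricSpace Graphon := PseudoMetricSpace.induced toL1 inferInstance
  have : SecondCountableTopology Graphon :=
    (Topology.IsInducing.induced toL1).secondCountableTopology
  obtain ⟨c, hc, hd⟩ := TopologicalSpace.exists_countable_dense Graphon
  exact ⟨c, hc, fun U ε hε => Metric.mem_closure_iff.1 (hd U) ε hε⟩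

instance : TopologicalSpace.SeparableSpace Graphon := by
  obtain ⟨c, hc, hd⟩ := exists_countable_dense_toL1
  refine ⟨c, hc, fun U => Metric.mem_closure_iff.2 fun ε hε => ?_⟩
  obtain ⟨V, hV, hUV⟩ := hd U ε hε
  exact ⟨V, hV, (dist_le_dist_toL1 U V).trans_lt hUV⟩

end Graphon

/-- The metric quotient of the set of graphons by `δ_□(U,V) = 0` (weak isomorphism). -/
abbrev GraphonSpace : Type := SeparationQuotient Graphon

noncomputable instance : MeasurableSpace GraphonSpace := borel GraphonSpace

instance : BorelSpace GraphonSpace := ⟨rfl⟩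

instance : TopologicalSpace.SeparableSpace GraphonSpace :=
  SeparationQuotient.surjective_mk.denseRange.separableSpace SeparationQuotient.continuous_mk

/-- Edge-weighted complete graphs on `n` vertices: weights in `[0,1]` on the unordered pairs of
distinct vertices. -/
abbrev EdgeWeights (n : ℕ) : Type := {e : Sym2 (Fin n) // ¬ e.IsDiag} → unitInterval

namespace EdgeWeights

/-- The weight of the pair `(i, j)`; there are no loops, so the diagonal has weight `0`. -/
def weight {n : ℕ} (H : EdgeWeights n) (i j : Fin n) : unitInterval :=
  if h : i = j then 0 else H ⟨s(i, j), by simpa using h⟩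

theorem weight_comm {n : ℕ} (H : EdgeWeights n) (i j : Fin n) : H.weight i j = H.weight j i := by
  unfold weight
  by_cases h : i = j
  · subst h
    rfl
  · rw [dif_neg h, dif_neg (Ne.symm h)]
    congr 2
    exact Sym2.eq_swap

end EdgeWeights

/-- The index `j` of the interval containing `x` when `[0,1]` is cut into
`[j/n, (j+1)/n)` for `j < n - 1` and `[(n-1)/n, 1]` for `j = n - 1`. -/
noncomputable def stepIndex (n : ℕ+) (x : unitInterval) : Fin n :=
  ⟨min ⌊(n : ℝ) * (x : ℝ)⌋₊ ((n : ℕ) - 1),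
    (min_le_right _ _).trans_lt (Nat.sub_lt n.pos one_pos)⟩

theorem measurable_stepIndex (n : ℕ+) : Measurable (stepIndex n) := by
  refine measurable_to_countable' fun j => ?_
  have h : Measurable fun x : unitInterval => min ⌊(n : ℝ) * (x : ℝ)⌋₊ ((n : ℕ) - 1) :=
    (Nat.measurable_floor.comp (measurable_subtype_coe.const_mul _)).min measurable_const
  have : stepIndex n ⁻¹' {j} = (fun x : unitInterval =>
      min ⌊(n : ℝ) * (x : ℝ)⌋₊ ((n : ℕ) - 1)) ⁻¹' {(j : ℕ)} := by
    ext x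
    simp [stepIndex, Fin.ext_iff]
  rw [this]
  exact h (measurableSet_singleton _)

/-- The `n`-step graphon of an edge-weighted complete graph on `n` vertices. -/
noncomputable def EdgeWeights.stepGraphon {n : ℕ+} (H : EdgeWeights n) : Graphon where
  toFun x y := H.weight (stepIndex n x) (stepIndex n y)
  symm' _ _ := H.weight_comm _ _
  measurable' := by
    have h : Measurable fun q : Fin n × Fin n => H.weight q.1 q.2 := measurable_of_countable _
    exact (h.comp ((measurable_stepIndex n).prodMap (measurable_stepIndex n))).nullMeasurable

open Classical in
/-- A graph as a complete graph with edge weights in `{0, 1}`. -/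
noncomputable def SimpleGraph.edgeWeights {n : ℕ} (G : SimpleGraph (Fin n)) : EdgeWeights n :=
  fun e => if e.1 ∈ G.edgeSet then 1 else 0

open Classical in
/-- The probability of the graph `G` when every pair `e` is made an edge with probability `H e`,
independently of all other pairs. -/
noncomputable def EdgeWeights.roundingProb {n : ℕ} (H : EdgeWeights n) (G : SimpleGraph (Fin n)) : ℝ :=
  ∏ e : {e : Sym2 (Fin n) // ¬ e.IsDiag},
    if e.1 ∈ G.edgeSet then (H e : ℝ) else 1 - (H e : ℝ)

namespace Graphon

/-- The edge-weighted complete graph with weight `W(x_i, x_j)` on the pair `{i, j}`. -/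
def sampleWeights (W : Graphon) {n : ℕ} (x : Fin n → unitInterval) : EdgeWeights n :=
  fun e => Sym2.lift ⟨fun i j => W (x i) (x j), fun _ _ => W.symm' _ _⟩ e.1

/-- The probability that the `n`-vertex `W`-sample equals `G`, that is, the induced density
`t_ind(G, W)`: the vertices `x_1, …, x_n` are independent and uniform on `[0,1]`, and given these
each pair `{i, j}` is independently an edge with probability `W(x_i, x_j)`. -/
noncomputable def sampleProb (W : Graphon) {n : ℕ} (G : SimpleGraph (Fin n)) : ℝ :=
  ∫ x : Fin n → unitInterval, (W.sampleWeights x).roundingProb G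

open Classical in
/-- The law of the weak isomorphism class of the `n`-vertex `W`-sample (a random graph). -/
noncomputable def graphLaw (W : Graphon) (n : ℕ+) : Measure GraphonSpace :=
  ∑ G : SimpleGraph (Fin n), ENNReal.ofReal (W.sampleProb G) •
    Measure.dirac (SeparationQuotient.mk G.edgeWeights.stepGraphon)

/-- The law of the weak isomorphism class of the weighted `n`-vertex `W`-sample. -/
noncomputable def weightedLaw (W : Graphon) (n : ℕ+) : Measure GraphonSpace :=
  (volume : Measure (Fin n → unitInterval)).map
    fun x => SeparationQuotient.mk (W.sampleWeights x).stepGraphon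

end Graphon

/-- Exponential equivalence for speed `s` of two sequences of Borel probability measures on a
separable metric space: there are couplings `Θ n` of `μ n` and `ν n` with
`limsup (1 / s n) * log (Θ n {d > α}) = -∞` for every `α > 0`. (As the space is separable, the
product σ-algebra on `X × X` is the Borel σ-algebra.) -/
def ExponentiallyEquivalent {X : Type*} [MetricSpace X] [TopologicalSpace.SeparableSpace X]
    [MeasurableSpace X] [BorelSpace X] (μ ν : ℕ+ → Measure X) (s : ℕ+ → ℝ) : Prop :=
  ∃ Θ : ℕ+ → Measure (X × X),
    (∀ n, IsProbabilityMeasure (Θ n) ∧ (Θ n).map Prod.fst = μ n ∧ (Θ n).map Prod.snd = ν n) ∧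
    ∀ α : ℝ, 0 < α →
      limsup (fun n => ((1 / s n : ℝ) : EReal) *
        ENNReal.log (Θ n {p : X × X | α < dist p.1 p.2})) atTop = ⊥

/-! Couple the two laws by sampling the weights `H` once and rounding each pair of vertices
independently to an edge with probability its weight. This is `sampleCoupling`: for each graph `G`,
the law of `H` is given the density `H.roundingProb G`.

Conditionally on `H`, every `boxDiff` over `S × T` is a sum of independent centred variables with
coefficients at most 2, so a Chernoff bound makes a deviation above `δ n²` of probability at most `2
exp(-δ² n² / 16)` (`sum_roundingProb_boxDiff_le`). Only finitely many boxes matter: integrating the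
difference of two step graphons over `A × B` gives a bilinear form in the masses of `A` and `B` on
the steps, each in `[0, 1/n]`, and such a form is extremal at vertices, that is, at pairs `(S, T)`
(`dist_stepGraphon_le_of_boxDiff_le`). Since `δ_□ ≤ d_□`, no relabelling is needed.

A union bound over the `4^n` boxes costs a factor exponential in `n`, negligible against `exp(-c
n²)`. The bound is uniform in `H`, so it survives integration over the sample, and it beats every
speed `o(n²)` (`limsup_log_eq_bot_of_le_exp_sq`). -/

/-! ### Bilinear forms on boxes. -/

/-- A linear form on a box `[0, t]^ι` is dominated by its value at a vertex. -/
theorem exists_finset_sum_mul_le {ι : Type*} [Fintype ι] {t : ℝ} (a c : ι → ℝ)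
    (h0 : ∀ i, 0 ≤ a i) (h1 : ∀ i, a i ≤ t) :
    ∃ S : Finset ι, ∑ i, a i * c i ≤ t * ∑ i ∈ S, c i := by
  classical
  refine ⟨Finset.univ.filter fun i => 0 ≤ c i, ?_⟩
  rw [Finset.mul_sum, Finset.sum_filter]
  refine Finset.sum_le_sum fun i _ => ?_
  split_ifs with h
  · exact mul_le_mul_of_nonneg_right (h1 i) h
  · exact mul_nonpos_of_nonneg_of_nonpos (h0 i) (not_le.1 h).le

/-- A bilinear form on a product of boxes is dominated by its value at a pair of vertices. -/
theorem exists_finset_bilinear_le {ι : Type*} [Fintype ι] {t : ℝ} (ht : 0 ≤ t) (f : ι → ι → ℝ)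
    (a b : ι → ℝ) (ha0 : ∀ i, 0 ≤ a i) (ha1 : ∀ i, a i ≤ t) (hb0 : ∀ i, 0 ≤ b i)
    (hb1 : ∀ i, b i ≤ t) :
    ∃ S T : Finset ι, ∑ i, ∑ j, a i * b j * f i j ≤ t ^ 2 * ∑ i ∈ S, ∑ j ∈ T, f i j := by
  -- One factor is optimised at a time: the form is linear in `a` for fixed `b`, and once `a` is
  -- replaced by `t` on `S` it is linear in `b`.
  obtain ⟨S, hS⟩ := exists_finset_sum_mul_le a (fun i => ∑ j, b j * f i j) ha0 ha1
  obtain ⟨T, hT⟩ := exists_finset_sum_mul_le b (fun j => ∑ i ∈ S, f i j) hb0 hb1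
  refine ⟨S, T, ?_⟩
  calc ∑ i, ∑ j, a i * b j * f i j = ∑ i, a i * ∑ j, b j * f i j := by
        simp only [Finset.mul_sum, mul_assoc]
    _ ≤ t * ∑ i ∈ S, ∑ j, b j * f i j := hS
    _ = t * ∑ j, b j * ∑ i ∈ S, f i j := by
        rw [Finset.sum_comm]
        simp only [Finset.mul_sum]
    _ ≤ t * (t * ∑ j ∈ T, ∑ i ∈ S, f i j) := mul_le_mul_of_nonneg_left hT ht
    _ = t ^ 2 * ∑ i ∈ S, ∑ j ∈ T, f i j := by
        rw [Finset.sum_comm]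
        ring

theorem abs_bilinear_le {ι : Type*} [Fintype ι] {t C : ℝ} (ht : 0 ≤ t) (f : ι → ι → ℝ)
    (a b : ι → ℝ) (ha0 : ∀ i, 0 ≤ a i) (ha1 : ∀ i, a i ≤ t) (hb0 : ∀ i, 0 ≤ b i)
    (hb1 : ∀ i, b i ≤ t) (h : ∀ S T : Finset ι, |∑ i ∈ S, ∑ j ∈ T, f i j| ≤ C) :
    |∑ i, ∑ j, a i * b j * f i j| ≤ t ^ 2 * C := by
  rw [abs_le]
  constructor
  · obtain ⟨S, T, hST⟩ :=
      exists_finset_bilinear_le ht (fun i j => -f i j) a b ha0 ha1 hb0 hb1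
    simp only [mul_neg, Finset.sum_neg_distrib] at hST
    have := mul_le_mul_of_nonneg_left (abs_le.1 (h S T)).1 (sq_nonneg t)
    linarith
  · obtain ⟨S, T, hST⟩ := exists_finset_bilinear_le ht f a b ha0 ha1 hb0 hb1
    exact hST.trans (mul_le_mul_of_nonneg_left (abs_le.1 (h S T)).2 (sq_nonneg t))

/-! ### Exponential moments of random rounding. -/

/-- The moment generating function of a centred Bernoulli variable. -/
theorem bernoulli_mgf_le {p c : ℝ} (h0 : 0 ≤ p) (h1 : p ≤ 1) (hc : |c| ≤ 1) :
    p * Real.exp (c * (1 - p)) + (1 - p) * Real.exp (c * (0 - p)) ≤ Real.exp (c ^ 2) := by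
  -- With `exp u ≤ 1 + u + u²` for `|u| ≤ 1`, the linear terms cancel in the mean and the quadratic
  -- ones sum to `c² p (1 - p)`.
  have key : ∀ y : ℝ, |y| ≤ 1 → Real.exp (c * y) ≤ 1 + c * y + c ^ 2 * y ^ 2 := fun y hy => by
    have h : |c * y| ≤ 1 := by
      rw [abs_mul]
      exact mul_le_one₀ hc (abs_nonneg _) hy
    have := (abs_le.1 (Real.abs_exp_sub_one_sub_id_le h)).2
    nlinarith
  have e1 := mul_le_mul_of_nonneg_left (key (1 - p) (abs_le.2 ⟨by linarith, by linarith⟩)) h0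
  have e2 := mul_le_mul_of_nonneg_left (key (0 - p) (abs_le.2 ⟨by linarith, by linarith⟩))
    (sub_nonneg.2 h1)
  have e3 : p * (1 - p) ≤ 1 := by nlinarith
  have e4 := mul_le_mul_of_nonneg_left e3 (sq_nonneg c)
  have e5 := Real.add_one_le_exp (c ^ 2)
  nlinarith

open Classical in
/-- Expanding a product over the pairs of vertices as a sum over graphs. -/
theorem SimpleGraph.sum_prod_ite_mem_edgeSet {n : ℕ}
    (a b : {e : Sym2 (Fin n) // ¬ e.IsDiag} → ℝ) :
    ∑ G : SimpleGraph (Fin n), ∏ e : {e : Sym2 (Fin n) // ¬ e.IsDiag},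
      (if e.1 ∈ G.edgeSet then a e else b e) = ∏ e, (a e + b e) := by
  rw [Fintype.prod_add]
  -- `Fintype.prod_add` runs over subsets of pairs. As the pairs are off-diagonal, `fromEdgeSet`
  -- discards nothing and these subsets are exactly the edge sets.
  refine Finset.sum_bij' (fun G _ => Finset.univ.filter fun e => e.1 ∈ G.edgeSet)
    (fun s _ => SimpleGraph.fromEdgeSet (Subtype.val '' (s : Set {e : Sym2 (Fin n) // ¬ e.IsDiag})))
    (fun _ _ => Finset.mem_univ _) (fun _ _ => Finset.mem_univ _) ?_ ?_ ?_
  · intro G _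
    ext i j
    simp only [SimpleGraph.fromEdgeSet_adj, Finset.coe_filter, Finset.mem_univ, true_and]
    constructor
    · rintro ⟨⟨e, he, h⟩, -⟩
      have he' : e.1 ∈ G.edgeSet := he
      rw [h] at he'
      exact he'
    · intro h
      exact ⟨⟨⟨s(i, j), by simpa using h.ne⟩, h, rfl⟩, h.ne⟩
  · intro s _
    ext e
    simp [SimpleGraph.edgeSet_fromEdgeSet, e.2]
  · intro G _
    rw [Finset.prod_ite, Finset.compl_filter]

namespace EdgeWeights

variable {n : ℕ}

open Classical in
theorem roundingProb_nonneg (H : EdgeWeights n) (G : SimpleGraph (Fin n)) :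
    0 ≤ H.roundingProb G := by
  refine Finset.prod_nonneg fun e _ => ?_
  split_ifs
  · exact (H e).2.1
  · exact sub_nonneg.2 (H e).2.2

open Classical in
theorem sum_roundingProb (H : EdgeWeights n) :
    ∑ G : SimpleGraph (Fin n), H.roundingProb G = 1 := by
  unfold roundingProb
  rw [SimpleGraph.sum_prod_ite_mem_edgeSet]
  simp

-- Independence of the pairs: probability and exponential both factor over pairs, so summing over
-- graphs yields a product of one-pair Bernoulli moment generating functions.
open Classical in
theorem sum_roundingProb_mul_exp_le (H : EdgeWeights n)
    (c : {e : Sym2 (Fin n) // ¬ e.IsDiag} → ℝ) (hc : ∀ e, |c e| ≤ 1) :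
    ∑ G : SimpleGraph (Fin n), H.roundingProb G *
      Real.exp (∑ e, c e * ((G.edgeWeights e : ℝ) - H e)) ≤ Real.exp (∑ e, c e ^ 2) := by
  have : ∀ G : SimpleGraph (Fin n), H.roundingProb G *
      Real.exp (∑ e, c e * ((G.edgeWeights e : ℝ) - H e)) =
      ∏ e : {e : Sym2 (Fin n) // ¬ e.IsDiag}, (if e.1 ∈ G.edgeSet then
        (H e : ℝ) * Real.exp (c e * (1 - H e)) else (1 - H e) * Real.exp (c e * (0 - H e))) := by
    intro G
    rw [Real.exp_sum, roundingProb, ← Finset.prod_mul_distrib]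
    refine Finset.prod_congr rfl fun e _ => ?_
    by_cases h : e.1 ∈ G.edgeSet <;> simp [SimpleGraph.edgeWeights, h]
  simp only [this]
  rw [SimpleGraph.sum_prod_ite_mem_edgeSet, Real.exp_sum]
  refine Finset.prod_le_prod (fun e _ => ?_) fun e _ =>
    bernoulli_mgf_le (H e).2.1 (H e).2.2 (hc e)
  exact add_nonneg (mul_nonneg (H e).2.1 (Real.exp_nonneg _))
    (mul_nonneg (sub_nonneg.2 (H e).2.2) (Real.exp_nonneg _))

/-- The difference of the weights of `K` and `H` on `S × T`. -/
def boxDiff (K H : EdgeWeights n) (S T : Finset (Fin n)) : ℝ :=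
  ∑ i ∈ S, ∑ j ∈ T, ((K.weight i j : ℝ) - H.weight i j)

-- Regroups ordered pairs into the unordered ones, which are the independent coordinates. The
-- diagonal drops out because both weights vanish there.
open Classical in
theorem boxDiff_eq (K H : EdgeWeights n) (S T : Finset (Fin n)) :
    boxDiff K H S T = ∑ e : {e : Sym2 (Fin n) // ¬ e.IsDiag},
      (((S ×ˢ T).filter fun p => s(p.1, p.2) = e.1).card : ℝ) * ((K e : ℝ) - H e) := by
  have h1 : ∀ i j : Fin n, ((K.weight i j : ℝ) - H.weight i j) =
      ∑ e : {e : Sym2 (Fin n) // ¬ e.IsDiag}, if s(i, j) = e.1 then (K e : ℝ) - H e else 0 := by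
    intro i j
    by_cases h : i = j
    · subst h
      rw [Finset.sum_eq_zero]
      · simp [weight]
      · intro e _
        rw [if_neg]
        intro h'
        exact e.2 (h' ▸ Sym2.mk_isDiag_iff.2 rfl)
    · rw [Finset.sum_eq_single ⟨s(i, j), by simpa using h⟩]
      · simp [weight, h]
      · rintro e - he
        rw [if_neg]
        rintro h'
        exact he (Subtype.ext h'.symm)
      · simp
  rw [boxDiff, ← Finset.sum_product' (f := fun i j => ((K.weight i j : ℝ) - H.weight i j))]
  simp only [h1]
  rw [Finset.sum_comm]
  refine Finset.sum_congr rfl fun e _ => ?_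
  rw [← Finset.sum_filter, Finset.sum_const, nsmul_eq_mul]

open Classical in
theorem card_filter_mk_eq_le (S T : Finset (Fin n)) (e : Sym2 (Fin n)) :
    ((S ×ˢ T).filter fun p => s(p.1, p.2) = e).card ≤ 2 := by
  induction e with
  | h i j =>
    refine (Finset.card_le_card (t := {(i, j), (j, i)}) fun p hp => ?_).trans Finset.card_le_two
    have := (Finset.mem_filter.1 hp).2
    rw [Sym2.eq_iff] at this
    simpa [Prod.ext_iff] using this

open Classical in
theorem card_pairs_le :
    (Fintype.card {e : Sym2 (Fin n) // ¬ e.IsDiag} : ℝ) ≤ (n : ℝ) ^ 2 := by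
  have h1 : Fintype.card (Sym2 (Fin n)) ≤ Fintype.card (Fin n × Fin n) :=
    Fintype.card_le_of_surjective (fun p => s(p.1, p.2)) fun e => by
      induction e with
      | h i j => exact ⟨(i, j), rfl⟩
  have h2 := (Fintype.card_subtype_le fun e : Sym2 (Fin n) => ¬ e.IsDiag).trans h1
  rw [Fintype.card_prod, Fintype.card_fin] at h2
  rw [pow_two]
  exact_mod_cast h2

-- Multiplicities are at most 2, so `|r| ≤ 1 / 2` keeps the coefficients `r * m e` within the range
-- of the Bernoulli bound. Their squares are at most `4 r²`, over at most `n²` pairs.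
open Classical in
theorem sum_roundingProb_mul_exp_boxDiff_le (H : EdgeWeights n) (S T : Finset (Fin n)) {r : ℝ}
    (hr : |r| ≤ 1 / 2) :
    ∑ G : SimpleGraph (Fin n), H.roundingProb G *
      Real.exp (r * boxDiff G.edgeWeights H S T) ≤ Real.exp (4 * r ^ 2 * (n : ℝ) ^ 2) := by
  set m : {e : Sym2 (Fin n) // ¬ e.IsDiag} → ℝ := fun e =>
    (((S ×ˢ T).filter fun p => s(p.1, p.2) = e.1).card : ℝ) with hm
  have hm0 : ∀ e, 0 ≤ m e := fun e => Nat.cast_nonneg _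
  have hm2 : ∀ e, m e ≤ 2 := fun e => by
    simp only [hm]
    exact_mod_cast card_filter_mk_eq_le S T e.1
  have h := H.sum_roundingProb_mul_exp_le (fun e => r * m e) fun e => by
    rw [abs_mul, abs_of_nonneg (hm0 e)]
    nlinarith [hm0 e, hm2 e, abs_nonneg r]
  refine (le_of_eq ?_).trans (h.trans (Real.exp_le_exp.2 ?_))
  · refine Finset.sum_congr rfl fun G _ => ?_
    rw [boxDiff_eq, Finset.mul_sum]
    simp only [mul_assoc, hm]
  · calc ∑ e, (r * m e) ^ 2 ≤ ∑ e : {e : Sym2 (Fin n) // ¬ e.IsDiag}, 4 * r ^ 2 := by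
          refine Finset.sum_le_sum fun e _ => ?_
          have : m e ^ 2 ≤ 4 := by nlinarith [hm0 e, hm2 e]
          nlinarith [sq_nonneg r]
      _ = 4 * r ^ 2 * Fintype.card {e : Sym2 (Fin n) // ¬ e.IsDiag} := by
          rw [Finset.sum_const, nsmul_eq_mul, Finset.card_univ, mul_comm]
      _ ≤ 4 * r ^ 2 * (n : ℝ) ^ 2 :=
          mul_le_mul_of_nonneg_left card_pairs_le (by positivity)

open Classical in
/-- Chernoff bound for the deviation of the rounded graph on one box. -/
theorem sum_roundingProb_boxDiff_le (H : EdgeWeights n) (S T : Finset (Fin n)) {δ : ℝ}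
    (hδ0 : 0 < δ) (hδ1 : δ ≤ 1) :
    ∑ G : SimpleGraph (Fin n),
      (if δ * (n : ℝ) ^ 2 < |boxDiff G.edgeWeights H S T| then H.roundingProb G else 0) ≤
      2 * Real.exp (-(δ ^ 2 / 16) * (n : ℝ) ^ 2) := by
  -- The exponent `4 r² - r δ` is least at `r = δ / 8`, with value `-δ² / 16`.
  have hr : |δ / 8| ≤ 1 / 2 := abs_le.2 ⟨by linarith, by linarith⟩
  have h1 := H.sum_roundingProb_mul_exp_boxDiff_le S T hr
  have h2 := H.sum_roundingProb_mul_exp_boxDiff_le S T (r := -(δ / 8)) (by rwa [abs_neg])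
  set q : ℝ := Real.exp (-(δ / 8 * (δ * (n : ℝ) ^ 2))) with hq
  -- Markov's inequality for both tails at once: on the deviation event, one of the two exponentials
  -- times `q` is at least 1.
  have h3 : ∀ G : SimpleGraph (Fin n),
      (if δ * (n : ℝ) ^ 2 < |boxDiff G.edgeWeights H S T| then H.roundingProb G else 0) ≤
      (H.roundingProb G * Real.exp (δ / 8 * boxDiff G.edgeWeights H S T) +
        H.roundingProb G * Real.exp (-(δ / 8) * boxDiff G.edgeWeights H S T)) * q := by
    intro G
    have hp := H.roundingProb_nonneg G
    split_ifs with h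
    · rw [← mul_add, mul_assoc]
      refine le_mul_of_one_le_right hp ?_
      rw [add_mul, hq, ← Real.exp_add, ← Real.exp_add]
      rcases lt_abs.1 h with h | h
      · refine le_add_of_le_of_nonneg (Real.one_le_exp ?_) (Real.exp_nonneg _)
        nlinarith
      · refine le_add_of_nonneg_of_le (Real.exp_nonneg _) (Real.one_le_exp ?_)
        nlinarith
    · positivity
  refine (Finset.sum_le_sum fun G _ => h3 G).trans ?_
  rw [← Finset.sum_mul, Finset.sum_add_distrib]
  refine (mul_le_mul_of_nonneg_right (add_le_add h1 h2) (Real.exp_nonneg _)).trans (le_of_eq ?_)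
  rw [neg_sq, ← two_mul, mul_assoc, ← Real.exp_add]
  ring_nf

end EdgeWeights

/-! ### Step graphons: masses of the steps, and dependence on the weights. -/

theorem volume_preimage_stepIndex_le (n : ℕ+) (j : Fin n) :
    (volume : Measure unitInterval) (stepIndex n ⁻¹' {j}) ≤ ENNReal.ofReal (1 / (n : ℝ)) := by
  have hn : (0 : ℝ) < n := by exact_mod_cast n.pos
  have hj : (j : ℝ) + 1 ≤ n := by exact_mod_cast j.2
  have hj0 : (0 : ℝ) ≤ j := Nat.cast_nonneg _
  let u : unitInterval := ⟨j / n, by positivity, (div_le_one hn).2 (by linarith)⟩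
  let v : unitInterval := ⟨(j + 1) / n, by positivity, (div_le_one hn).2 hj⟩
  have hsub : stepIndex n ⁻¹' {j} ⊆ Set.Icc u v := by
    intro x hx
    have hx : min ⌊(n : ℝ) * (x : ℝ)⌋₊ ((n : ℕ) - 1) = j := congrArg Fin.val hx
    have hx0 : 0 ≤ (n : ℝ) * (x : ℝ) := mul_nonneg hn.le x.2.1
    constructor
    · change (j : ℝ) / n ≤ x
      rw [div_le_iff₀' hn]
      exact (Nat.le_floor_iff hx0).1 (hx ▸ min_le_left _ _)
    · change (x : ℝ) ≤ ((j : ℝ) + 1) / n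
      rw [le_div_iff₀' hn]
      rcases le_total ⌊(n : ℝ) * (x : ℝ)⌋₊ ((n : ℕ) - 1) with h | h
      · rw [min_eq_left h] at hx
        rw [← hx]
        exact (Nat.lt_floor_add_one _).le
      -- When the floor is truncated, `j = n - 1`; the last step reaches the endpoint 1, so `x ≤ 1`
      -- is the bound required.
      · rw [min_eq_right h] at hx
        have h2 : (j : ℕ) + 1 = n := by have := n.pos; omega
        have h3 : (j : ℝ) + 1 = n := by exact_mod_cast h2
        rw [h3]
        exact mul_le_of_le_one_right hn.le x.2.2
  refine (measure_mono hsub).trans ?_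
  rw [unitInterval.volume_Icc]
  refine ENNReal.ofReal_le_ofReal (le_of_eq ?_)
  change ((j : ℝ) + 1) / n - j / n = 1 / n
  ring

/-- The integral of the difference of two step graphons over a box is a bilinear form in the
masses of the steps. -/
theorem EdgeWeights.setIntegral_diff_stepGraphon {n : ℕ+} (K H : EdgeWeights n)
    (A B : Set unitInterval) :
    ∃ a b : Fin n → ℝ, (∀ i, 0 ≤ a i) ∧ (∀ i, a i ≤ 1 / (n : ℝ)) ∧ (∀ i, 0 ≤ b i) ∧
      (∀ i, b i ≤ 1 / (n : ℝ)) ∧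
      ∫ p in A ×ˢ B, Graphon.diff K.stepGraphon H.stepGraphon p =
        ∑ i, ∑ j, a i * b j * ((K.weight i j : ℝ) - H.weight i j) := by
  have hs := measurable_stepIndex n
  -- The mass of `A` on step `i` is the mass of `{i}` under the push-forward to `Fin n`; the
  -- integral becomes one over the finite set `Fin n × Fin n`.
  set μ : Set unitInterval → Measure (Fin n) := fun A => (volume.restrict A).map (stepIndex n)
    with hμ
  have hle : ∀ A i, (μ A).real {i} ≤ 1 / (n : ℝ) := fun A i => by
    refine ENNReal.toReal_le_of_le_ofReal (by positivity) ?_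
    rw [hμ, Measure.map_apply hs (measurableSet_singleton _)]
    exact (Measure.restrict_apply_le _ _).trans (volume_preimage_stepIndex_le n i)
  refine ⟨fun i => (μ A).real {i}, fun i => (μ B).real {i}, fun i => measureReal_nonneg,
    hle A, fun i => measureReal_nonneg, hle B, ?_⟩
  have hprod : (μ A).prod (μ B) =
      (volume.restrict (A ×ˢ B)).map (Prod.map (stepIndex n) (stepIndex n)) := by
    rw [hμ, Measure.map_prod_map _ _ hs hs, Measure.prod_restrict]
    rfl
  have hm : Measurable fun q : Fin n × Fin n => ((K.weight q.1 q.2 : ℝ) - H.weight q.1 q.2) :=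
    measurable_of_countable _
  calc ∫ p in A ×ˢ B, Graphon.diff K.stepGraphon H.stepGraphon p
      = ∫ q, ((K.weight q.1 q.2 : ℝ) - H.weight q.1 q.2) ∂((μ A).prod (μ B)) := by
        rw [hprod, integral_map (hs.prodMap hs).aemeasurable hm.aestronglyMeasurable]
        rfl
    _ = _ := by
        rw [integral_fintype Integrable.of_finite, Fintype.sum_prod_type]
        refine Finset.sum_congr rfl fun i _ => Finset.sum_congr rfl fun j _ => ?_
        rw [← Set.singleton_prod_singleton, measureReal_prod_prod, smul_eq_mul]

/-- The sup distance of the weights dominates the `L¹` distance of the graphons. This crude bound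
serves to make the class of the step graphon continuous, hence measurable, in the weights. -/
theorem EdgeWeights.dist_stepGraphon_le {n : ℕ+} (K H : EdgeWeights n) :
    dist K.stepGraphon H.stepGraphon ≤ dist K H := by
  refine (Graphon.dist_le_integral _ _).trans ?_
  refine (integral_mono (Graphon.integrable_diff _ _).abs (integrable_const (dist K H))
    fun p => ?_).trans (by simp)
  change |((K.weight (stepIndex n p.1) (stepIndex n p.2) : ℝ) -
    H.weight (stepIndex n p.1) (stepIndex n p.2))| ≤ dist K H
  unfold weight
  split_ifs with h
  · simp
  · exact dist_le_pi_dist K H _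

theorem EdgeWeights.continuous_mk_stepGraphon (n : ℕ+) :
    Continuous fun H : EdgeWeights n => (SeparationQuotient.mk H.stepGraphon : GraphonSpace) :=
  SeparationQuotient.continuous_mk.comp
    (LipschitzWith.of_dist_le_mul (K := 1) fun K H => by
      simpa using K.dist_stepGraphon_le H).continuous

open Classical in
theorem EdgeWeights.continuous_roundingProb {n : ℕ} (G : SimpleGraph (Fin n)) :
    Continuous fun H : EdgeWeights n => H.roundingProb G := by
  unfold roundingProb
  refine continuous_finsetProd _ fun e _ => ?_
  split_ifs <;> fun_prop

/-! ### The coupling and its marginals. -/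

namespace Graphon

/-- `W` is measurable only for the completed σ-algebra, so `W (x i) (x j)` is a.e. measurable in `x`
because null sets of the square pull back to null sets. This is where `i ≠ j` matters. -/
theorem measurePreserving_eval_pair {n : ℕ} {i j : Fin n} (h : i ≠ j) :
    MeasurePreserving (fun x : Fin n → unitInterval => (x i, x j)) volume volume := by
  refine ⟨by fun_prop, ?_⟩
  have hind := (ProbabilityTheory.iIndepFun_pi (μ := fun _ : Fin n => (volume : Measure unitInterval))
    (X := fun _ => id) fun _ => aemeasurable_id).indepFun h
  have := (ProbabilityTheory.indepFun_iff_map_prod_eq_prod_map_map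
    (measurable_pi_apply i).aemeasurable (measurable_pi_apply j).aemeasurable).1 hind
  refine this.trans ?_
  have he := fun k => (measurePreserving_eval
    (fun _ : Fin n => (volume : Measure unitInterval)) k).map_eq
  exact congrArg₂ Measure.prod (he i) (he j)

theorem aemeasurable_sampleWeights (W : Graphon) (n : ℕ) :
    AEMeasurable (fun x : Fin n → unitInterval => W.sampleWeights x) volume := by
  rw [aemeasurable_pi_iff]
  rintro ⟨e, he⟩
  induction e with
  | h i j =>
    have hij : i ≠ j := by simpa using he
    exact W.measurable'.aemeasurable.comp_quasiMeasurePreserving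
      (measurePreserving_eval_pair hij).quasiMeasurePreserving

/-- The law of the edge weights of the weighted `n`-vertex `W`-sample. -/
noncomputable def weightsLaw (W : Graphon) (n : ℕ) : Measure (EdgeWeights n) :=
  (volume : Measure (Fin n → unitInterval)).map fun x => W.sampleWeights x

instance (W : Graphon) (n : ℕ) : IsProbabilityMeasure (W.weightsLaw n) :=
  Measure.isProbabilityMeasure_map (W.aemeasurable_sampleWeights n)

/-- The joint law of the `W`-sample and the weighted `W`-sample on the same vertices. -/
noncomputable def sampleCoupling (W : Graphon) (n : ℕ+) : Measure (GraphonSpace × GraphonSpace) :=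
  open Classical in
  ∑ G : SimpleGraph (Fin n),
    ((W.weightsLaw n).withDensity fun H => ENNReal.ofReal (H.roundingProb G)).map
      fun H => (SeparationQuotient.mk G.edgeWeights.stepGraphon,
        SeparationQuotient.mk H.stepGraphon)

/-- Makes `dist` measurable for the product σ-algebra, so that the deviation events are measurable.
-/
instance : SecondCountableTopology GraphonSpace :=
  UniformSpace.secondCountable_of_separable _

theorem measurable_mk_stepGraphon (n : ℕ+) :
    Measurable fun H : EdgeWeights n => (SeparationQuotient.mk H.stepGraphon : GraphonSpace) :=
  (EdgeWeights.continuous_mk_stepGraphon n).measurable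

theorem measurable_pair_mk_stepGraphon {n : ℕ+} (K : EdgeWeights n) :
    Measurable fun H : EdgeWeights n => ((SeparationQuotient.mk K.stepGraphon : GraphonSpace),
      (SeparationQuotient.mk H.stepGraphon : GraphonSpace)) :=
  measurable_const.prodMk (measurable_mk_stepGraphon n)

theorem measurable_ofReal_roundingProb {n : ℕ} (G : SimpleGraph (Fin n)) :
    Measurable fun H : EdgeWeights n => ENNReal.ofReal (H.roundingProb G) :=
  (EdgeWeights.continuous_roundingProb G).measurable.ennreal_ofReal

theorem ofReal_sampleProb (W : Graphon) {n : ℕ} (G : SimpleGraph (Fin n)) :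
    ENNReal.ofReal (W.sampleProb G) =
      ∫⁻ H, ENNReal.ofReal (H.roundingProb G) ∂W.weightsLaw n := by
  have hc := EdgeWeights.continuous_roundingProb G
  rw [sampleProb, weightsLaw, lintegral_map' (measurable_ofReal_roundingProb G).aemeasurable
    (W.aemeasurable_sampleWeights n)]
  rw [← integral_map (W.aemeasurable_sampleWeights n) hc.aestronglyMeasurable,
    ofReal_integral_eq_lintegral_ofReal ?_ (Eventually.of_forall fun H => H.roundingProb_nonneg G),
    lintegral_map' (measurable_ofReal_roundingProb G).aemeasurable
    (W.aemeasurable_sampleWeights n)]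
  have := W.aemeasurable_sampleWeights n
  have : IsProbabilityMeasure
    ((volume : Measure (Fin n → unitInterval)).map fun x => W.sampleWeights x) :=
    Measure.isProbabilityMeasure_map this
  exact hc.integrable_of_hasCompactSupport (HasCompactSupport.of_compactSpace _)

open Classical in
theorem sum_ofReal_roundingProb {n : ℕ} (H : EdgeWeights n) :
    ∑ G : SimpleGraph (Fin n), ENNReal.ofReal (H.roundingProb G) = 1 := by
  rw [← ENNReal.ofReal_sum_of_nonneg fun G _ => H.roundingProb_nonneg G, H.sum_roundingProb,
    ENNReal.ofReal_one]

theorem weightedLaw_eq_map_weightsLaw (W : Graphon) (n : ℕ+) :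
    W.weightedLaw n = (W.weightsLaw n).map
      fun H => (SeparationQuotient.mk H.stepGraphon : GraphonSpace) :=
  (AEMeasurable.map_map_of_aemeasurable (measurable_mk_stepGraphon n).aemeasurable
    (W.aemeasurable_sampleWeights n)).symm

/-- For fixed `G` the first coordinate is constant, so each summand becomes a point mass weighted by
the integral of its density, the sampling probability of `G`. -/
theorem map_fst_sampleCoupling (W : Graphon) (n : ℕ+) :
    (W.sampleCoupling n).map Prod.fst = W.graphLaw n := by
  classical
  rw [sampleCoupling, Measure.map_finset_sum measurable_fst.aemeasurable, graphLaw]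
  refine Finset.sum_congr rfl fun G _ => ?_
  rw [Measure.map_map measurable_fst (measurable_pair_mk_stepGraphon _), ofReal_sampleProb]
  change Measure.map (fun _ => SeparationQuotient.mk G.edgeWeights.stepGraphon) _ = _
  rw [Measure.map_const, withDensity_apply _ MeasurableSet.univ, Measure.restrict_univ]

/-- The second coordinate does not depend on `G`, and the densities sum to 1 over `G`. -/
theorem map_snd_sampleCoupling (W : Graphon) (n : ℕ+) :
    (W.sampleCoupling n).map Prod.snd = W.weightedLaw n := by
  classical
  rw [weightedLaw_eq_map_weightsLaw, sampleCoupling, Measure.map_finset_sum measurable_snd.aemeasurable]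
  ext S hS
  rw [Measure.finsetSum_apply, Measure.map_apply (measurable_mk_stepGraphon n) hS]
  have hS' := measurable_mk_stepGraphon n hS
  calc _ = ∑ G : SimpleGraph (Fin n), ∫⁻ H in
        (fun H : EdgeWeights n => (SeparationQuotient.mk H.stepGraphon : GraphonSpace)) ⁻¹' S,
        ENNReal.ofReal (H.roundingProb G) ∂W.weightsLaw n := by
        refine Finset.sum_congr rfl fun G _ => ?_
        rw [Measure.map_map measurable_snd (measurable_pair_mk_stepGraphon _),
          Measure.map_apply (measurable_snd.comp (measurable_pair_mk_stepGraphon _)) hS,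
          ← withDensity_apply _ hS']
        rfl
    _ = _ := by
        rw [← lintegral_finsetSum _ fun G _ => measurable_ofReal_roundingProb G]
        simp only [sum_ofReal_roundingProb]
        simp

instance (W : Graphon) (n : ℕ+) : IsProbabilityMeasure (W.sampleCoupling n) := by
  constructor
  have h := congrArg (fun μ => μ Set.univ) (W.map_snd_sampleCoupling n)
  have : IsProbabilityMeasure (W.weightedLaw n) := by
    rw [weightedLaw_eq_map_weightsLaw]
    exact Measure.isProbabilityMeasure_map (measurable_mk_stepGraphon n).aemeasurable
  simpa [Measure.map_apply measurable_snd MeasurableSet.univ] using h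

end Graphon

/-! ### Deviation in cut-distance: union bound over boxes. -/

namespace EdgeWeights

/-- The step masses lie in `[0, 1/n]`, so the vertex bound contributes `(1/n)²`, which cancels the
`n²`. -/
theorem dist_stepGraphon_le_of_boxDiff_le {n : ℕ+} (K H : EdgeWeights n) {δ : ℝ}
    (h : ∀ S T, |boxDiff K H S T| ≤ δ * (n : ℝ) ^ 2) :
    dist K.stepGraphon H.stepGraphon ≤ δ := by
  have hn : (0 : ℝ) < n := by exact_mod_cast n.pos
  refine (Graphon.cutDistance_le_cutDist _ _).trans (Graphon.cutDist_le _ _ fun A B _ _ => ?_)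
  obtain ⟨a, b, ha0, ha1, hb0, hb1, hab⟩ := K.setIntegral_diff_stepGraphon H A B
  rw [hab]
  refine (abs_bilinear_le (by positivity) _ a b ha0 ha1 hb0 hb1 h).trans (le_of_eq ?_)
  field_simp

-- A distance above `δ` forces a large deviation on some box, and there are `2^n * 2^n` choices of
-- `(S, T)`.
open Classical in
theorem sum_roundingProb_dist_le {n : ℕ+} (H : EdgeWeights n) {δ : ℝ} (hδ0 : 0 < δ)
    (hδ1 : δ ≤ 1) :
    ∑ G : SimpleGraph (Fin n),
      (if δ < dist G.edgeWeights.stepGraphon H.stepGraphon then H.roundingProb G else 0) ≤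
      2 ^ (n : ℕ) * 2 ^ (n : ℕ) * (2 * Real.exp (-(δ ^ 2 / 16) * (n : ℝ) ^ 2)) := by
  have h1 : ∀ G : SimpleGraph (Fin n),
      (if δ < dist G.edgeWeights.stepGraphon H.stepGraphon then H.roundingProb G else 0) ≤
      ∑ S : Finset (Fin n), ∑ T : Finset (Fin n),
        if δ * (n : ℝ) ^ 2 < |boxDiff G.edgeWeights H S T| then H.roundingProb G else 0 := by
    intro G
    have hp := H.roundingProb_nonneg G
    have h0 : ∀ S T : Finset (Fin n), 0 ≤
        if δ * (n : ℝ) ^ 2 < |boxDiff G.edgeWeights H S T| then H.roundingProb G else 0 :=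
      fun S T => by split_ifs <;> simp [hp]
    split_ifs with h
    · obtain ⟨S, T, hST⟩ : ∃ S T, δ * (n : ℝ) ^ 2 < |boxDiff G.edgeWeights H S T| := by
        by_contra! hc
        exact h.not_ge (dist_stepGraphon_le_of_boxDiff_le _ _ hc)
      refine le_trans ?_ (Finset.single_le_sum (fun S _ => Finset.sum_nonneg fun T _ => h0 S T)
        (Finset.mem_univ S))
      refine le_trans ?_ (Finset.single_le_sum (fun T _ => h0 S T) (Finset.mem_univ T))
      rw [if_pos hST]
    · exact Finset.sum_nonneg fun S _ => Finset.sum_nonneg fun T _ => h0 S T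
  refine (Finset.sum_le_sum fun G _ => h1 G).trans ?_
  rw [Finset.sum_comm]
  simp only [Finset.sum_comm (s := (Finset.univ : Finset (SimpleGraph (Fin n))))]
  refine (Finset.sum_le_sum fun S _ => Finset.sum_le_sum fun T _ =>
    H.sum_roundingProb_boxDiff_le S T hδ0 hδ1).trans (le_of_eq ?_)
  simp [Finset.sum_const, Finset.card_univ, Fintype.card_finset, mul_assoc]

end EdgeWeights

namespace Graphon

/-- The conditional bound does not depend on `H`, so it integrates to itself. The threshold is
lowered from `α` to `δ` because the Chernoff bound needs `δ ≤ 1`. -/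
theorem sampleCoupling_dist_le (W : Graphon) (n : ℕ+) {α δ : ℝ} (hδ0 : 0 < δ) (hδ1 : δ ≤ 1)
    (hδα : δ ≤ α) :
    W.sampleCoupling n {p | α < dist p.1 p.2} ≤ ENNReal.ofReal
      (2 ^ (n : ℕ) * 2 ^ (n : ℕ) * (2 * Real.exp (-(δ ^ 2 / 16) * (n : ℝ) ^ 2))) := by
  classical
  have hS : MeasurableSet {p : GraphonSpace × GraphonSpace | δ < dist p.1 p.2} :=
    measurableSet_lt measurable_const measurable_dist
  have hsub : {p : GraphonSpace × GraphonSpace | α < dist p.1 p.2} ⊆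
      {p : GraphonSpace × GraphonSpace | δ < dist p.1 p.2} := fun _ hp => hδα.trans_lt hp
  refine (measure_mono hsub).trans ?_
  rw [sampleCoupling, Measure.finsetSum_apply]
  have h1 : ∀ G : SimpleGraph (Fin n), MeasurableSet
      {H : EdgeWeights n | δ < dist G.edgeWeights.stepGraphon H.stepGraphon} := fun G =>
    measurable_pair_mk_stepGraphon G.edgeWeights hS
  calc _ = ∑ G : SimpleGraph (Fin n), ∫⁻ H,
        {H : EdgeWeights n | δ < dist G.edgeWeights.stepGraphon H.stepGraphon}.indicator
          (fun H => ENNReal.ofReal (H.roundingProb G)) H ∂W.weightsLaw n := by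
        refine Finset.sum_congr rfl fun G _ => ?_
        rw [Measure.map_apply (measurable_pair_mk_stepGraphon _) hS, lintegral_indicator (h1 G),
          ← withDensity_apply _ (h1 G)]
        rfl
    _ = ∫⁻ H, ∑ G : SimpleGraph (Fin n),
        {H : EdgeWeights n | δ < dist G.edgeWeights.stepGraphon H.stepGraphon}.indicator
          (fun H => ENNReal.ofReal (H.roundingProb G)) H ∂W.weightsLaw n :=
        (lintegral_finsetSum _ fun G _ =>
          (measurable_ofReal_roundingProb G).indicator (h1 G)).symm
    _ ≤ ∫⁻ _ : EdgeWeights n, ENNReal.ofReal (2 ^ (n : ℕ) * 2 ^ (n : ℕ) *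
        (2 * Real.exp (-(δ ^ 2 / 16) * (n : ℝ) ^ 2))) ∂W.weightsLaw n := by
        refine lintegral_mono fun H => ?_
        refine le_trans (le_of_eq ?_)
          (ENNReal.ofReal_le_ofReal (H.sum_roundingProb_dist_le hδ0 hδ1))
        rw [ENNReal.ofReal_sum_of_nonneg fun G _ => by
          split_ifs <;> simp [H.roundingProb_nonneg G]]
        refine Finset.sum_congr rfl fun G _ => ?_
        by_cases h : δ < dist G.edgeWeights.stepGraphon H.stepGraphon <;> simp [h]
    _ = _ := by simp

end Graphon

/-! ### Comparison with the speed, and conclusion. -/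

/-- A probability of order `exp (-c n²)` is superexponentially small for every speed `o(n²)`. -/
theorem limsup_log_eq_bot_of_le_exp_sq {s : ℕ+ → ℝ} (hs_pos : ∀ n, 0 < s n)
    (hs_small : Tendsto (fun n : ℕ+ => s n / (n : ℝ) ^ 2) atTop (𝓝 0)) {c : ℝ} (hc : 0 < c)
    {P : ℕ+ → ENNReal} (hP : ∀ n, P n ≤ ENNReal.ofReal
      (2 ^ (n : ℕ) * 2 ^ (n : ℕ) * (2 * Real.exp (-c * (n : ℝ) ^ 2)))) :
    limsup (fun n => ((1 / s n : ℝ) : EReal) * ENNReal.log (P n)) atTop = ⊥ := by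
  have hlim : ∀ K : ℝ, limsup (fun n => ((1 / s n : ℝ) : EReal) * ENNReal.log (P n)) atTop ≤
      (K : EReal) := by
    intro K
    refine limsup_le_of_le (by isBoundedDefault) ?_
    -- Chosen so that `(|K| + 1) s n ≤ (c / 2) n²`, whence `-(c / 2) n² ≤ K s n`.
    have hsm : ∀ᶠ n : ℕ+ in atTop, s n / (n : ℝ) ^ 2 < c / 2 / (|K| + 1) :=
      hs_small.eventually_lt_const (by positivity)
    -- The prefactor has logarithm `(2n + 1) log 2 ≤ 3n`, which is at most `(c / 2) n²` once `c n ≥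
    -- 6`; half of the exponent remains.
    obtain ⟨N, hN⟩ := exists_nat_gt (6 / c)
    filter_upwards [hsm, eventually_ge_atTop N.toPNat'] with n h1 h2
    have hn : (1 : ℝ) ≤ n := by exact_mod_cast n.pos
    have hNn : (N : ℝ) ≤ n := by
      have h3 : (N.toPNat' : ℕ) ≤ n := h2
      rw [Nat.toPNat'_coe] at h3
      split_ifs at h3 with h4
      · exact_mod_cast h3
      -- `toPNat'` sends 0 to 1, so `N = 0` is a separate case.
      · have : N = 0 := by omega
        subst this
        simp
    have h3 : 6 ≤ c * n := by
      rw [div_lt_iff₀ hc] at hN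
      nlinarith
    have hlog : Real.log (2 ^ (n : ℕ) * 2 ^ (n : ℕ) * (2 * Real.exp (-c * (n : ℝ) ^ 2))) ≤
        -(c / 2) * (n : ℝ) ^ 2 := by
      have hl2 : Real.log 2 ≤ 1 := by linarith [Real.log_two_lt_d9]
      rw [Real.log_mul (by positivity) (by positivity), Real.log_mul (by positivity)
        (by positivity), Real.log_mul (by positivity) (by positivity), Real.log_exp, Real.log_pow]
      nlinarith
    have hfin : 1 / s n * Real.log (2 ^ (n : ℕ) * 2 ^ (n : ℕ) *
        (2 * Real.exp (-c * (n : ℝ) ^ 2))) ≤ K := by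
      rw [one_div_mul_eq_div, div_le_iff₀ (hs_pos n)]
      refine hlog.trans ?_
      rw [div_lt_div_iff₀ (by positivity) (by positivity)] at h1
      nlinarith [neg_abs_le K, hs_pos n]
    calc ((1 / s n : ℝ) : EReal) * ENNReal.log (P n)
        ≤ ((1 / s n : ℝ) : EReal) * ENNReal.log (ENNReal.ofReal
          (2 ^ (n : ℕ) * 2 ^ (n : ℕ) * (2 * Real.exp (-c * (n : ℝ) ^ 2)))) :=
          mul_le_mul_of_nonneg_left (ENNReal.log_monotone (hP n))
            (EReal.coe_nonneg.2 (one_div_pos.2 (hs_pos n)).le)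
      _ = ((1 / s n * Real.log (2 ^ (n : ℕ) * 2 ^ (n : ℕ) *
          (2 * Real.exp (-c * (n : ℝ) ^ 2))) : ℝ) : EReal) := by
          rw [ENNReal.log_ofReal_of_pos (by positivity), ← EReal.coe_mul]
      _ ≤ K := EReal.coe_le_coe_iff.2 hfin
  rw [EReal.eq_bot_iff_forall_lt]
  -- Shifting to `y - 1` turns the weak bound into a strict one.
  exact fun y => (hlim (y - 1)).trans_lt (EReal.coe_lt_coe_iff.2 (by linarith))

theorem mainTheorem7 (W : Graphon) (s : ℕ+ → ℝ) (hs_pos : ∀ n, 0 < s n)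
    (hs_top : Tendsto s atTop atTop)
    (hs_small : Tendsto (fun n : ℕ+ => s n / (n : ℝ) ^ 2) atTop (𝓝 0)) :
    ExponentiallyEquivalent W.graphLaw W.weightedLaw s := by
  refine ⟨W.sampleCoupling, fun n => ⟨inferInstance, W.map_fst_sampleCoupling n,
    W.map_snd_sampleCoupling n⟩, fun α hα => ?_⟩
  have hδ : 0 < min α 1 := lt_min hα one_pos
  exact limsup_log_eq_bot_of_le_exp_sq hs_pos hs_small (c := min α 1 ^ 2 / 16) (by positivity)
    fun n => W.sampleCoupling_dist_le n hδ (min_le_right _ _) (min_le_left _ _)
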